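/- Let $\Bbbk$ be a field and let $\chi\colon E\to H$ be a crossed module, that is, a group homomorphism together with a left action $(x,e)\mapsto {}^{x}e$ of $H$ on $E$ by group automorphisms such that $\chi({}^{x}e)=x\chi(e)x^{-1}$ and ${}^{\chi(e)}f=efe^{-1}$ for all $x\in H$, $e,f\in E$. A Hopf $H$-coalgebra is a family $A=\{A_x\}_{x\in H}$ of $\Bbbk$-algebras with algebra homomorphisms $\Delta_{x,y}\colon A_{xy}\to A_x\otimes A_y$ and $\varepsilon\colon A_1\to\Bbbk$ and $\Bbbk$-linear isomorphisms $S_x\colon A_{x^{-1}}\to A_x$ such that, for all $x,y,z\in H$, $$(\Delta_{x,y}\otimes \mathrm{id})\Delta_{xy,z}=(\mathrm{id}\otimes\Delta_{y,z})\Delta_{x,yz},\qquad (\mathrm{id}\otimes\varepsilon)\Delta_{x,1}=\mathrm{id}_{A_x}=(\varepsilon\otimes\mathrm{id})\Delta_{1,x},$$ $$\mu_x(S_x\otimes\mathrm{id})\Delta_{x^{-1},x}=\eta_x\varepsilon=\mu_x(\mathrm{id}\otimes S_x)\Delta_{x,x^{-1}},$$ where $\mu_x$ and $\eta_x$ are the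 product and the unit map of $A_x$. A Hopf $\chi$-coalgebra is a Hopf $H$-coalgebra with algebra homomorphisms $\phi_{x,e}\colon A_x\to A_{\chi(e)x}$ $(x\in H,\ e\in E)$ such that $\phi_{x,1}=\mathrm{id}$, $\phi_{\chi(e)x,f}\,\phi_{x,e}=\phi_{x,fe}$ and $(\phi_{x,e}\otimes\phi_{y,f})\Delta_{x,y}=\Delta_{\chi(e)x,\chi(f)y}\,\phi_{xy,\,e\,{}^{x}f}$. It is of finite type if every $A_x$ is finite-dimensional, and involutory if $S_xS_{x^{-1}}=\mathrm{id}_{A_x}$ for all $x\in H$. A two-sided integral element of $A_1$ is an element $\Lambda\in A_1$ with $\Lambda a=\varepsilon(a)\Lambda=a\Lambda$ for all $a\in A_1$. A two-sided $\chi$-integral on $A$ is a family of linear forms $\lambda=\{\lambda_x\colon A_x\to\Bbbk\}_{x\in H}$ such that, for all $x,y\in H$ and $e\in E$, $$(\mathrm{id}\otimes\lambda_y)\Delta_{x,y}=\eta_x\lambda_{xy},\qquad (\lambda_x\otimes\mathrm{id})\Delta_{x,y}=\eta_y\lambda_{xy},\qquad \lambda_{\chi(e)x}\,\phi_{x,e}=\lambda_x.$$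 **Lemma.** Let $A$ be an involutory Hopf $\chi$-coalgebra of finite type such that the characteristic of $\Bbbk$ does not divide $\dim_\Bbbk A_1$. Then there are a unique two-sided integral element $\Lambda$ of $A_1$ with $\varepsilon(\Lambda)=\dim_\Bbbk(A_1)1_\Bbbk$ and a unique two-sided $\chi$-integral $\lambda$ on $A$ with $\lambda_x(1_x)=\dim_\Bbbk(A_1)1_\Bbbk$ for all $x\in H$ such that $A_x\neq 0$. They satisfy $\lambda_1(\Lambda)=\dim_\Bbbk(A_1)1_\Bbbk$. Moreover, for all $x\in H$ and $a,b\in A_x$, $$\sigma\,\Delta_{x,x^{-1}}(\Lambda)=\Delta_{x^{-1},x}(\Lambda),\qquad \lambda_x(ba)=\lambda_x(ab),\qquad S_1(\Lambda)=\Lambda,\qquad \lambda_xS_x=\lambda_{x^{-1}},$$ where $\sigma\colon A_x\otimes A_{x^{-1}}\to A_{x^{-1}}\otimes A_x$ is the flip. -/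

import Mathlib

open scoped TensorProduct

/-- A crossed module `χ : E → H`: a group homomorphism together with a left action of `H` on `E`
by group automorphisms, such that `χ` is equivariant for the conjugation action of `H` on itself
and the Peiffer identity holds. -/
structure CrossedModule (E H : Type*) [Group E] [Group H] where
  hom : E →* H
  act : H →* MulAut E
  equivariant : ∀ (x : H) (e : E), hom (act x e) = x * hom e * x⁻¹
  peiffer : ∀ e f : E, act (hom e) f = e * f * e⁻¹

/-- A Hopf `H`-coalgebra structure on a family `A = {A_x}_{x ∈ H}` of `k`-algebras.

To avoid transporting elements along equalities of indices, the structure maps whose source is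
indexed by a product or an inverse take that index together with an equation identifying it:
`comul x y z h` with `h : x * y = z` is the coproduct `Δ_{x,y} : A_{xy} → A_x ⊗ A_y`, and
`antipode x y h` with `h : x⁻¹ = y` is `S_x : A_{x⁻¹} → A_x`. -/
structure HopfGroupCoalgebra (k : Type*) [Field k] {H : Type*} [Group H] (A : H → Type*)
    [∀ x, Ring (A x)] [∀ x, Algebra k (A x)] where
  /-- The coproduct `Δ_{x,y} : A_{xy} → A_x ⊗ A_y`, an algebra homomorphism. -/
  comul : ∀ x y z : H, x * y = z → (A z →ₐ[k] A x ⊗[k] A y)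
  /-- The counit, an algebra homomorphism. -/
  counit : A 1 →ₐ[k] k
  /-- The antipode `S_x : A_{x⁻¹} → A_x`, a linear isomorphism. -/
  antipode : ∀ x y : H, x⁻¹ = y → (A y ≃ₗ[k] A x)
  /-- `(Δ_{x,y} ⊗ id) Δ_{xy,z} = (id ⊗ Δ_{y,z}) Δ_{x,yz}`. -/
  coassoc : ∀ (x y z xy yz w : H) (hxy : x * y = xy) (hyz : y * z = yz)
      (h₁ : xy * z = w) (h₂ : x * yz = w),
    (TensorProduct.assoc k (A x) (A y) (A z)).toLinearMap ∘ₗ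
        (comul x y xy hxy).toLinearMap.rTensor (A z) ∘ₗ (comul xy z w h₁).toLinearMap =
      (comul y z yz hyz).toLinearMap.lTensor (A x) ∘ₗ (comul x yz w h₂).toLinearMap
  /-- `(id ⊗ ε) Δ_{x,1} = id`. -/
  comul_counit : ∀ x : H,
    (TensorProduct.rid k (A x)).toLinearMap ∘ₗ counit.toLinearMap.lTensor (A x) ∘ₗ
      (comul x 1 x (mul_one x)).toLinearMap = LinearMap.id
  /-- `(ε ⊗ id) Δ_{1,x} = id`. -/
  counit_comul : ∀ x : H,
    (TensorProduct.lid k (A x)).toLinearMap ∘ₗ counit.toLinearMap.rTensor (A x) ∘ₗ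
      (comul 1 x x (one_mul x)).toLinearMap = LinearMap.id
  /-- `μ_x (S_x ⊗ id) Δ_{x⁻¹,x} = η_x ε`. -/
  antipode_mul_id : ∀ (x y : H) (hS : x⁻¹ = y) (h : y * x = 1),
    LinearMap.mul' k (A x) ∘ₗ (antipode x y hS).toLinearMap.rTensor (A x) ∘ₗ
        (comul y x 1 h).toLinearMap =
      Algebra.linearMap k (A x) ∘ₗ counit.toLinearMap
  /-- `μ_x (id ⊗ S_x) Δ_{x,x⁻¹} = η_x ε`. -/
  id_mul_antipode : ∀ (x y : H) (hS : x⁻¹ = y) (h : x * y = 1),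
    LinearMap.mul' k (A x) ∘ₗ (antipode x y hS).toLinearMap.lTensor (A x) ∘ₗ
        (comul x y 1 h).toLinearMap =
      Algebra.linearMap k (A x) ∘ₗ counit.toLinearMap

/-- A Hopf `χ`-coalgebra: a Hopf `H`-coalgebra together with a `χ`-action, that is, algebra
homomorphisms `φ_{x,e} : A_x → A_{χ(e)x}`. Here `action x e y h` with `h : χ(e) * x = y` is
`φ_{x,e}`. -/
structure HopfCrossedCoalgebra (k : Type*) [Field k] {E H : Type*} [Group E] [Group H]
    (χ : CrossedModule E H) (A : H → Type*) [∀ x, Ring (A x)] [∀ x, Algebra k (A x)]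
    extends HopfGroupCoalgebra k A where
  action : ∀ (x : H) (e : E) (y : H), χ.hom e * x = y → (A x →ₐ[k] A y)
  /-- `φ_{x,1} = id`. -/
  action_one : ∀ (x : H) (h : χ.hom 1 * x = x), action x 1 x h = AlgHom.id k (A x)
  /-- `φ_{χ(e)x,f} φ_{x,e} = φ_{x,fe}`. -/
  action_mul : ∀ (x : H) (e f : E) (y z : H) (hy : χ.hom e * x = y) (hz : χ.hom f * y = z)
      (h : χ.hom (f * e) * x = z),
    (action y f z hz).comp (action x e y hy) = action x (f * e) z h
  /-- `(φ_{x,e} ⊗ φ_{y,f}) Δ_{x,y} = Δ_{χ(e)x,χ(f)y} φ_{xy, e (ˣf)}`. -/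
  action_comul : ∀ (x y z x' y' z' : H) (e f : E) (hz : x * y = z)
      (hx' : χ.hom e * x = x') (hy' : χ.hom f * y = y') (hz' : x' * y' = z')
      (h : χ.hom (e * χ.act x f) * z = z'),
    (Algebra.TensorProduct.map (action x e x' hx') (action y f y' hy')).comp (comul x y z hz) =
      (comul x' y' z' hz').comp (action z (e * χ.act x f) z' h)

namespace HopfGroupCoalgebra

variable {k : Type*} [Field k] {H : Type*} [Group H] {A : H → Type*}
  [∀ x, Ring (A x)] [∀ x, Algebra k (A x)]

/-- Every `A_x` is finite-dimensional. -/
def IsFiniteType (_B : HopfGroupCoalgebra k A) : Prop :=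
  ∀ x : H, FiniteDimensional k (A x)

/-- `S_x S_{x⁻¹} = id` on `A_x`, for all `x`. -/
def IsInvolutory (B : HopfGroupCoalgebra k A) : Prop :=
  ∀ (x y : H) (hx : x⁻¹ = y) (hy : y⁻¹ = x) (a : A x),
    B.antipode x y hx (B.antipode y x hy a) = a

/-- The coproduct `Δ^cop_{x,y} = σ Δ_{y⁻¹,x⁻¹} : A_{(xy)⁻¹} → A_{x⁻¹} ⊗ A_{y⁻¹}` of the coopposite
Hopf coalgebra, where `σ` is the flip; the indices `x'`, `y'`, `w` stand for `x⁻¹`, `y⁻¹`,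
`(xy)⁻¹`. -/
def comulCop (B : HopfGroupCoalgebra k A) (x y x' y' w : H)
    (hx : x⁻¹ = x') (hy : y⁻¹ = y') (hw : (x * y)⁻¹ = w) : A w →ₗ[k] A x' ⊗[k] A y' :=
  (TensorProduct.comm k (A y') (A x')).toLinearMap ∘ₗ
    (B.comul y' x' w (by rw [← hx, ← hy, ← hw, mul_inv_rev])).toLinearMap

/-- Two-sided integral elements of the Hopf algebra `A_1`. -/
def IsIntegralElement (B : HopfGroupCoalgebra k A) (Λ : A 1) : Prop :=
  ∀ a : A 1, Λ * a = B.counit a • Λ ∧ a * Λ = B.counit a • Λ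

/-- `Δ^cop_{x,x⁻¹}(Λ) = Δ_{x⁻¹,x}(Λ)` for all `x`. -/
def IsCosymmetric (B : HopfGroupCoalgebra k A) (Λ : A 1) : Prop :=
  ∀ (x y : H) (hx : x⁻¹ = y) (hy : y⁻¹ = x) (h : (x * y)⁻¹ = 1) (h' : y * x = 1),
    B.comulCop x y y x 1 hx hy h Λ = B.comul y x 1 h' Λ

end HopfGroupCoalgebra

namespace HopfCrossedCoalgebra

variable {k : Type*} [Field k] {E H : Type*} [Group E] [Group H] {χ : CrossedModule E H}
  {A : H → Type*} [∀ x, Ring (A x)] [∀ x, Algebra k (A x)]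

/-- Two-sided `χ`-integrals: families of linear forms `l_x : A_x → k` such that
`(id ⊗ l_y) Δ_{x,y} = η_x l_{xy}`, `(l_x ⊗ id) Δ_{x,y} = η_y l_{xy}` and
`l_{χ(e)x} φ_{x,e} = l_x`. -/
structure IsIntegral (B : HopfCrossedCoalgebra k χ A) (l : ∀ x, A x →ₗ[k] k) : Prop where
  id_tensor : ∀ (x y z : H) (h : x * y = z),
    (TensorProduct.rid k (A x)).toLinearMap ∘ₗ (l y).lTensor (A x) ∘ₗ
      (B.comul x y z h).toLinearMap = Algebra.linearMap k (A x) ∘ₗ l z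
  tensor_id : ∀ (x y z : H) (h : x * y = z),
    (TensorProduct.lid k (A y)).toLinearMap ∘ₗ (l x).rTensor (A y) ∘ₗ
      (B.comul x y z h).toLinearMap = Algebra.linearMap k (A y) ∘ₗ l z
  comp_action : ∀ (x : H) (e : E) (y : H) (h : χ.hom e * x = y),
    l y ∘ₗ (B.action x e y h).toLinearMap = l x

end HopfCrossedCoalgebra

/-! Both integrals are regular characters. Take `λ_x(a)` to be the trace of right multiplication by
`a` on `A_x`, and let `Λ` represent `g ↦ Tr(b ↦ g(b₁) b₂)` on the dual of `A_1`. In Sweedler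
notation, involutivity adds `S(a₂) a₁ = ε(a) 1` to the antipode axioms, because `S` is
antimultiplicative (`antipode_mul`). Hence `b ⊗ 1 = (1 ⊗ S(b₂)) Δ(b₁)`. This factors the
endomorphism computing `g((λ_x ⊗ id) Δ(a))` through `A_{xy}`, and cyclicity of the trace
(`trace_lift_contract_comp`) turns it into `g(1)` times right multiplication by `a`. The other side
is a mirror image, and similar trace manipulations make `Λ` two-sided. The remaining claims rest on
`(λ_y ⊗ id)((a ⊗ 1) Δ(Λ)) = λ_1(Λ) S(a)` (`sliceLeft_tmul_one_mul_comul`), where `λ_1(Λ) = dim A_1 ≠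
0`. It makes `(a, b) ↦ λ_y(ab)` nondegenerate. Comparison with its mirror image gives cosymmetry,
putting `a = Λ` gives `S(Λ) = Λ`, and applying `λ_x` gives `λ S = λ`. -/

namespace TensorProduct

/-! ### Slices, contractions and cyclicity of the trace -/

variable {k : Type*} [Field k] {V W C D : Type*} [AddCommGroup V] [Module k V]
  [AddCommGroup W] [Module k W] [AddCommGroup C] [Module k C] [AddCommGroup D] [Module k D]

/-- The slice map `id ⊗ g : V ⊗ C → V`. -/
noncomputable def sliceRight (V : Type*) [AddCommGroup V] [Module k V] (g : C →ₗ[k] k) :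
    V ⊗[k] C →ₗ[k] V :=
  (TensorProduct.rid k V).toLinearMap ∘ₗ g.lTensor V

/-- The slice map `g ⊗ id : C ⊗ V → V`. -/
noncomputable def sliceLeft (V : Type*) [AddCommGroup V] [Module k V] (g : C →ₗ[k] k) :
    C ⊗[k] V →ₗ[k] V :=
  (TensorProduct.lid k V).toLinearMap ∘ₗ g.rTensor V

@[simp] theorem sliceRight_tmul (g : C →ₗ[k] k) (v : V) (c : C) :
    sliceRight V g (v ⊗ₜ c) = g c • v := by simp [sliceRight]

@[simp] theorem sliceLeft_tmul (g : C →ₗ[k] k) (v : V) (c : C) :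
    sliceLeft V g (c ⊗ₜ v) = g c • v := by simp [sliceLeft]

/-- The contraction `v ⊗ d ↦ (c ↦ β c d • v)`. -/
noncomputable def contract (V : Type*) [AddCommGroup V] [Module k V] (β : C →ₗ[k] D →ₗ[k] k) :
    V ⊗[k] D →ₗ[k] C →ₗ[k] V :=
  TensorProduct.lift ((LinearMap.smulRightₗ ∘ₗ β.flip).flip)

@[simp] theorem contract_tmul (β : C →ₗ[k] D →ₗ[k] k) (v : V) (d : D) (c : C) :
    contract V β (v ⊗ₜ d) c = β c d • v := by simp [contract]

/-- Cyclicity of the trace for maps with values in tensor products. -/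
theorem trace_lift_contract_comp [FiniteDimensional k V] [FiniteDimensional k W]
    (F : V →ₗ[k] W ⊗[k] C) (G : W →ₗ[k] V ⊗[k] D) (β : C →ₗ[k] D →ₗ[k] k) :
    LinearMap.trace k V (TensorProduct.lift (contract V β ∘ₗ G) ∘ₗ F) =
      LinearMap.trace k W (TensorProduct.lift (contract W β.flip ∘ₗ F) ∘ₗ G) := by
  -- By finite-dimensionality `F` and `G` are sums of maps `v ↦ f v ⊗ c` and `w ↦ g w ⊗ d`. For
  -- these both sides are `β c d` times a trace of `f` and `g` composed.
  obtain ⟨F, rfl⟩ := (rTensorHomEquivHomRTensor k V W C).surjective F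
  obtain ⟨G, rfl⟩ := (rTensorHomEquivHomRTensor k W V D).surjective G
  induction F using TensorProduct.induction_on with
  | zero => simp [show TensorProduct.lift (0 : V →ₗ[k] D →ₗ[k] W) = 0 by ext; simp]
  | add F F' h h' =>
    have hadd (a b : V →ₗ[k] D →ₗ[k] W) : TensorProduct.lift (a + b) = lift a + lift b := by
      ext; simp
    simp only [map_add, LinearMap.comp_add, LinearMap.add_comp, hadd, h, h']
  | tmul f c =>
    induction G using TensorProduct.induction_on with
    | zero => simp [show TensorProduct.lift (0 : W →ₗ[k] C →ₗ[k] V) = 0 by ext; simp]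
    | add G G' h h' =>
      have hadd (a b : W →ₗ[k] C →ₗ[k] V) : TensorProduct.lift (a + b) = lift a + lift b := by
        ext; simp
      simp only [map_add, LinearMap.comp_add, LinearMap.add_comp, hadd, h, h']
    | tmul g d =>
      have h1 : TensorProduct.lift (contract V β ∘ₗ rTensorHomEquivHomRTensor k W V D (g ⊗ₜ d)) ∘ₗ
          rTensorHomEquivHomRTensor k V W C (f ⊗ₜ c) = β c d • (g ∘ₗ f) := by
        ext v; simp
      have h2 : TensorProduct.lift (contract W β.flip ∘ₗ
          rTensorHomEquivHomRTensor k V W C (f ⊗ₜ c)) ∘ₗ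
          rTensorHomEquivHomRTensor k W V D (g ⊗ₜ d) = β c d • (f ∘ₗ g) := by
        ext v; simp
      rw [h1, h2, map_smul, map_smul, LinearMap.trace_comp_comm']

section Algebra

variable {R S : Type*} [Ring R] [Algebra k R] [Ring S] [Algebra k S]

theorem sliceLeft_one_tmul_mul (g : R →ₗ[k] k) (c : S) (t : R ⊗[k] S) :
    sliceLeft S g ((1 ⊗ₜ c) * t) = c * sliceLeft S g t := by
  induction t using TensorProduct.induction_on with
  | zero => simp
  | add s t hs ht => simp [mul_add, hs, ht]
  | tmul p q => simp

theorem sliceLeft_mul_one_tmul (g : R →ₗ[k] k) (c : S) (t : R ⊗[k] S) :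
    sliceLeft S g (t * (1 ⊗ₜ c)) = sliceLeft S g t * c := by
  induction t using TensorProduct.induction_on with
  | zero => simp
  | add s t hs ht => simp [add_mul, hs, ht]
  | tmul p q => simp

theorem sliceRight_tmul_one_mul (g : S →ₗ[k] k) (c : R) (t : R ⊗[k] S) :
    sliceRight R g ((c ⊗ₜ 1) * t) = c * sliceRight R g t := by
  induction t using TensorProduct.induction_on with
  | zero => simp
  | add s t hs ht => simp [mul_add, hs, ht]
  | tmul p q => simp

end Algebra

end TensorProduct

open TensorProduct

namespace HopfGroupCoalgebra

variable {k : Type*} [Field k] {H : Type*} [Group H] {A : H → Type*}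
  [∀ x, Ring (A x)] [∀ x, Algebra k (A x)] (B : HopfGroupCoalgebra k A)

/-! ### Counit and antipode identities -/

theorem sliceRight_counit_comul (x : H) (h : x * 1 = x) (a : A x) :
    sliceRight (A x) B.counit.toLinearMap (B.comul x 1 x h a) = a :=
  LinearMap.congr_fun (B.comul_counit x) a

theorem sliceLeft_counit_comul (x : H) (h : 1 * x = x) (a : A x) :
    sliceLeft (A x) B.counit.toLinearMap (B.comul 1 x x h a) = a :=
  LinearMap.congr_fun (B.counit_comul x) a

theorem coassoc_apply (x y z xy yz w : H) (hxy : x * y = xy) (hyz : y * z = yz)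
    (h₁ : xy * z = w) (h₂ : x * yz = w) (a : A w) :
    TensorProduct.assoc k (A x) (A y) (A z)
        ((B.comul x y xy hxy).toLinearMap.rTensor (A z) (B.comul xy z w h₁ a)) =
      (B.comul y z yz hyz).toLinearMap.lTensor (A x) (B.comul x yz w h₂ a) :=
  LinearMap.congr_fun (B.coassoc x y z xy yz w hxy hyz h₁ h₂) a

/-- Coassociativity regroups the last two legs into `Δ_{p,q}`, which `m` collapses to the counit.
With its mirror image, this is the common mechanism behind every antipode cancellation below. -/
theorem lTensor_assoc_rTensor_comul {M : Type*} [AddCommGroup M] [Module k M] {x p q z : H}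
    (h : x * p = z) (hpq : p * q = 1) (h' : z * q = x) (m : A p ⊗[k] A q →ₗ[k] M) (e : M)
    (hm : ∀ c, m (B.comul p q 1 hpq c) = B.counit c • e) (a : A x) :
    m.lTensor (A x) (TensorProduct.assoc k (A x) (A p) (A q)
      ((B.comul x p z h).toLinearMap.rTensor (A q) (B.comul z q x h' a))) = a ⊗ₜ e := by
  rw [B.coassoc_apply x p q z 1 x h hpq h' (mul_one x)]
  have key : ∀ t : A x ⊗[k] A 1, m.lTensor (A x) ((B.comul p q 1 hpq).toLinearMap.lTensor (A x) t)
      = sliceRight (A x) B.counit.toLinearMap t ⊗ₜ e := by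
    intro t
    induction t using TensorProduct.induction_on with
    | zero => simp
    | add s t hs ht => simp [hs, ht, add_tmul]
    | tmul u v => simp [hm, smul_tmul]
  rw [key, B.sliceRight_counit_comul]

theorem rTensor_assoc_symm_lTensor_comul {M : Type*} [AddCommGroup M] [Module k M] {p q y z : H}
    (h : q * y = z) (hpq : p * q = 1) (h' : p * z = y) (m : A p ⊗[k] A q →ₗ[k] M) (e : M)
    (hm : ∀ c, m (B.comul p q 1 hpq c) = B.counit c • e) (a : A y) :
    m.rTensor (A y) ((TensorProduct.assoc k (A p) (A q) (A y)).symm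
      ((B.comul q y z h).toLinearMap.lTensor (A p) (B.comul p z y h' a))) = e ⊗ₜ a := by
  rw [← B.coassoc_apply p q y 1 z y hpq h (one_mul y) h', LinearEquiv.symm_apply_apply]
  have key : ∀ t : A 1 ⊗[k] A y, m.rTensor (A y) ((B.comul p q 1 hpq).toLinearMap.rTensor (A y) t)
      = e ⊗ₜ sliceLeft (A y) B.counit.toLinearMap t := by
    intro t
    induction t using TensorProduct.induction_on with
    | zero => simp
    | add s t hs ht => simp [hs, ht, tmul_add]
    | tmul u v => simp [hm, smul_tmul]
  rw [key, B.sliceLeft_counit_comul]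

theorem antipode_mul_id_apply {x y : H} (hS : x⁻¹ = y) (h : y * x = 1) (a : A 1) :
    LinearMap.mul' k (A x) ((B.antipode x y hS).toLinearMap.rTensor (A x) (B.comul y x 1 h a)) =
      B.counit a • 1 := by
  rw [← Algebra.algebraMap_eq_smul_one]
  exact LinearMap.congr_fun (B.antipode_mul_id x y hS h) a

theorem id_mul_antipode_apply {x y : H} (hS : x⁻¹ = y) (h : x * y = 1) (a : A 1) :
    LinearMap.mul' k (A x) ((B.antipode x y hS).toLinearMap.lTensor (A x) (B.comul x y 1 h a)) =
      B.counit a • 1 := by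
  rw [← Algebra.algebraMap_eq_smul_one]
  exact LinearMap.congr_fun (B.id_mul_antipode x y hS h) a

/-- The map `u ⊗ v ↦ Δ(u) (1 ⊗ S v)`. -/
noncomputable def comulMulAntipode {x y y' z : H} (h : x * y = z) (hS : y⁻¹ = y') :
    A z ⊗[k] A y' →ₗ[k] A x ⊗[k] A y :=
  TensorProduct.lift ((LinearMap.mul k (A x ⊗[k] A y)).compl₁₂ (B.comul x y z h).toLinearMap
    (TensorProduct.mk k (A x) (A y) 1 ∘ₗ (B.antipode y y' hS).toLinearMap))

/-- The map `u ⊗ v ↦ (1 ⊗ S v) Δ(u)`. -/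
noncomputable def antipodeMulComul {x y y' z : H} (h : x * y = z) (hS : y⁻¹ = y') :
    A z ⊗[k] A y' →ₗ[k] A x ⊗[k] A y :=
  TensorProduct.lift ((LinearMap.mul k (A x ⊗[k] A y)).flip.compl₁₂ (B.comul x y z h).toLinearMap
    (TensorProduct.mk k (A x) (A y) 1 ∘ₗ (B.antipode y y' hS).toLinearMap))

/-- The map `v ⊗ u ↦ (S v ⊗ 1) Δ(u)`. -/
noncomputable def antipodeMulComulLeft {x y x' z : H} (h : x * y = z) (hS : x⁻¹ = x') :
    A x' ⊗[k] A z →ₗ[k] A x ⊗[k] A y :=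
  TensorProduct.lift ((LinearMap.mul k (A x ⊗[k] A y)).compl₁₂
    ((TensorProduct.mk k (A x) (A y)).flip 1 ∘ₗ (B.antipode x x' hS).toLinearMap)
    (B.comul x y z h).toLinearMap)

/-- The map `p ⊗ q ↦ p₁ ⊗ S(p₂) q`. -/
noncomputable def comulAntipodeMul {x y y' z : H} (h : z * y' = x) (hS : y⁻¹ = y') :
    A x ⊗[k] A y →ₗ[k] A z ⊗[k] A y :=
  TensorProduct.lift ((LinearMap.mul k (A z ⊗[k] A y)).compl₁₂
    ((B.antipode y y' hS).toLinearMap.lTensor (A z) ∘ₗ (B.comul z y' x h).toLinearMap)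
    (TensorProduct.mk k (A z) (A y) 1))

/-- The map `p ⊗ q ↦ S(q₁) p ⊗ q₂`. -/
noncomputable def comulAntipodeMulLeft {x y x' z : H} (h : x' * z = y) (hS : x⁻¹ = x') :
    A x ⊗[k] A y →ₗ[k] A x ⊗[k] A z :=
  TensorProduct.lift ((LinearMap.mul k (A x ⊗[k] A z)).flip.compl₁₂
    ((TensorProduct.mk k (A x) (A z)).flip 1)
    ((B.antipode x x' hS).toLinearMap.rTensor (A z) ∘ₗ (B.comul x' z y h).toLinearMap))

@[simp] theorem comulMulAntipode_tmul {x y y' z : H} (h : x * y = z) (hS : y⁻¹ = y')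
    (u : A z) (v : A y') : B.comulMulAntipode h hS (u ⊗ₜ v) =
      B.comul x y z h u * (1 ⊗ₜ B.antipode y y' hS v) := rfl

@[simp] theorem antipodeMulComul_tmul {x y y' z : H} (h : x * y = z) (hS : y⁻¹ = y')
    (u : A z) (v : A y') : B.antipodeMulComul h hS (u ⊗ₜ v) =
      (1 ⊗ₜ B.antipode y y' hS v) * B.comul x y z h u := rfl

@[simp] theorem antipodeMulComulLeft_tmul {x y x' z : H} (h : x * y = z) (hS : x⁻¹ = x')
    (v : A x') (u : A z) : B.antipodeMulComulLeft h hS (v ⊗ₜ u) =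
      (B.antipode x x' hS v ⊗ₜ 1) * B.comul x y z h u := rfl

@[simp] theorem comulAntipodeMul_tmul {x y y' z : H} (h : z * y' = x) (hS : y⁻¹ = y')
    (p : A x) (q : A y) : B.comulAntipodeMul h hS (p ⊗ₜ q) =
      (B.antipode y y' hS).toLinearMap.lTensor (A z) (B.comul z y' x h p) * (1 ⊗ₜ q) := rfl

@[simp] theorem comulAntipodeMulLeft_tmul {x y x' z : H} (h : x' * z = y) (hS : x⁻¹ = x')
    (p : A x) (q : A y) : B.comulAntipodeMulLeft h hS (p ⊗ₜ q) =
      (B.antipode x x' hS).toLinearMap.rTensor (A z) (B.comul x' z y h q) * (p ⊗ₜ 1) := rfl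

/-- The cancellation `b₁ ⊗ b₂ S(b₃) = b ⊗ 1`, from the ordinary antipode axiom. -/
theorem comulMulAntipode_comul {x y y' z : H} (h : x * y = z) (hS : y⁻¹ = y') (h' : z * y' = x)
    (b : A x) : B.comulMulAntipode h hS (B.comul z y' x h' b) = b ⊗ₜ 1 := by
  have hy : y * y' = 1 := by simp [← hS]
  rw [← B.lTensor_assoc_rTensor_comul h hy h' 
      (LinearMap.mul' k (A y) ∘ₗ (B.antipode y y' hS).toLinearMap.lTensor (A y)) _
      (B.id_mul_antipode_apply hS hy) b]
  induction B.comul z y' x h' b using TensorProduct.induction_on with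
  | zero => simp
  | add s t hs ht => simp only [map_add, hs, ht]
  | tmul u v =>
    rw [comulMulAntipode_tmul, LinearMap.rTensor_tmul, AlgHom.toLinearMap_apply]
    induction B.comul x y z h u using TensorProduct.induction_on with
    | zero => simp
    | add s t hs ht => simp only [add_mul, add_tmul, map_add, hs, ht]
    | tmul p q => simp

theorem comulAntipodeMul_comul {x y y' z : H} (h : x * y = z) (hS : y⁻¹ = y') (h' : z * y' = x)
    (w : A z) : B.comulAntipodeMul h' hS (B.comul x y z h w) = w ⊗ₜ 1 := by
  have hy : y' * y = 1 := by simp [← hS]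
  rw [← B.lTensor_assoc_rTensor_comul h' hy h 
      (LinearMap.mul' k (A y) ∘ₗ (B.antipode y y' hS).toLinearMap.rTensor (A y)) _
      (B.antipode_mul_id_apply hS hy) w]
  induction B.comul x y z h w using TensorProduct.induction_on with
  | zero => simp
  | add s t hs ht => simp only [map_add, hs, ht]
  | tmul u v =>
    rw [comulAntipodeMul_tmul, LinearMap.rTensor_tmul, AlgHom.toLinearMap_apply]
    induction B.comul z y' x h' u using TensorProduct.induction_on with
    | zero => simp
    | add s t hs ht => simp only [add_mul, add_tmul, map_add, hs, ht]
    | tmul p q => simp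

theorem antipodeMulComulLeft_comul {x y x' z : H} (h : x * y = z) (hS : x⁻¹ = x')
    (h' : x' * z = y) (b : A y) :
    B.antipodeMulComulLeft h hS (B.comul x' z y h' b) = 1 ⊗ₜ b := by
  have hx : x' * x = 1 := by simp [← hS]
  rw [← B.rTensor_assoc_symm_lTensor_comul h hx h' 
      (LinearMap.mul' k (A x) ∘ₗ (B.antipode x x' hS).toLinearMap.rTensor (A x)) _
      (B.antipode_mul_id_apply hS hx) b]
  induction B.comul x' z y h' b using TensorProduct.induction_on with
  | zero => simp
  | add s t hs ht => simp only [map_add, hs, ht]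
  | tmul v u =>
    rw [antipodeMulComulLeft_tmul, LinearMap.lTensor_tmul, AlgHom.toLinearMap_apply]
    induction B.comul x y z h u using TensorProduct.induction_on with
    | zero => simp
    | add s t hs ht => simp only [mul_add, tmul_add, map_add, hs, ht]
    | tmul p q => simp

theorem antipode_one {x y : H} (hS : x⁻¹ = y) : B.antipode x y hS 1 = 1 := by
  have h := B.antipode_mul_id_apply hS (by simp [← hS]) 1
  simpa [Algebra.TensorProduct.one_def] using h

/-- Writing `a ⊗ 1 = Δ(a₁)(1 ⊗ S(a₂))`, and likewise for `b`, reduces everything to `N Δ = ε`.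
Evaluating `N` on `(a ⊗ 1)(b ⊗ 1)` directly gives `S(ab)`, and through these expansions `S(b) S(a)`.
-/
theorem antipode_mul {x y : H} (hS : x⁻¹ = y) (a b : A y) :
    B.antipode x y hS (a * b) = B.antipode x y hS b * B.antipode x y hS a := by
  have hyx : y * x = 1 := by simp [← hS]
  set N := LinearMap.mul' k (A x) ∘ₗ (B.antipode x y hS).toLinearMap.rTensor (A x) with hN
  have hNΔ : ∀ c, N (B.comul y x 1 hyx c) = B.counit c • 1 := B.antipode_mul_id_apply hS hyx
  have hNmul : ∀ t e, N (t * (1 ⊗ₜ e)) = N t * e := by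
    intro t e
    induction t using TensorProduct.induction_on with
    | zero => simp
    | add s t hs ht => simp only [add_mul, map_add, hs, ht]
    | tmul p q => simp [hN, mul_assoc]
  have h1 : ∀ (c : A 1) (t : A 1 ⊗[k] A y), N (B.comul y x 1 hyx c * B.comulMulAntipode hyx hS t) =
      B.counit c • B.antipode x y hS (sliceLeft (A y) B.counit.toLinearMap t) := by
    intro c t
    induction t using TensorProduct.induction_on with
    | zero => simp
    | add s t hs ht => simp only [mul_add, map_add, hs, ht, smul_add]
    | tmul u v =>
      rw [comulMulAntipode_tmul, ← mul_assoc, ← map_mul, hNmul, hNΔ]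
      simp [mul_smul]
  have h2 : ∀ t : A 1 ⊗[k] A y, N (B.comulMulAntipode hyx hS t * (b ⊗ₜ 1)) =
      B.antipode x y hS b * B.antipode x y hS (sliceLeft (A y) B.counit.toLinearMap t) := by
    intro t
    induction t using TensorProduct.induction_on with
    | zero => simp
    | add s t hs ht => simp only [add_mul, mul_add, map_add, hs, ht]
    | tmul u v =>
      have h3 := h1 u (B.comul 1 y y (one_mul y) b)
      rw [comulMulAntipode_comul, sliceLeft_counit_comul] at h3
      rw [comulMulAntipode_tmul, mul_assoc, Algebra.TensorProduct.tmul_mul_tmul, one_mul, mul_one,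
        show b ⊗ₜ[k] B.antipode x y hS v = (b ⊗ₜ 1) * (1 ⊗ₜ B.antipode x y hS v) by simp,
        ← mul_assoc, hNmul, h3]
      simp
  have h4 := h2 (B.comul 1 y y (one_mul y) a)
  rw [comulMulAntipode_comul, sliceLeft_counit_comul] at h4
  simpa [hN] using h4

variable {B}

/-- In an involutory Hopf coalgebra, `S(a₂) a₁ = ε(a) 1`. -/
theorem IsInvolutory.lift_antipode_mul (hB : B.IsInvolutory) {x y : H} (hS : x⁻¹ = y)
    (h : x * y = 1) (a : A 1) :
    TensorProduct.lift ((LinearMap.mul k (A x)).flip.compl₂ (B.antipode x y hS).toLinearMap)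
      (B.comul x y 1 h a) = B.counit a • 1 := by
  have hS' : y⁻¹ = x := by simp [← hS]
  -- Apply `S_x` to `S_y(a₁) a₂ = ε(a) 1`: antimultiplicativity swaps the factors, and `S_x S_y =
  -- id` leaves `S_x(a₂) a₁`.
  rw [← B.antipode_one hS, ← map_smul, ← B.antipode_mul_id_apply hS' h]
  induction B.comul x y 1 h a using TensorProduct.induction_on with
  | zero => simp
  | add s t hs ht => simp only [map_add, hs, ht]
  | tmul u v => simp [antipode_mul, hB x y hS hS']

/-- The cancellation `b₁ ⊗ S(b₃) b₂ = b ⊗ 1`, whose reversed order of factors is where involutivity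
enters. -/
theorem IsInvolutory.antipodeMulComul_comul (hB : B.IsInvolutory) {x y y' z : H} (h : x * y = z)
    (hS : y⁻¹ = y') (h' : z * y' = x) (b : A x) :
    B.antipodeMulComul h hS (B.comul z y' x h' b) = b ⊗ₜ 1 := by
  have hy : y * y' = 1 := by simp [← hS]
  rw [← B.lTensor_assoc_rTensor_comul h hy h' _ _ (hB.lift_antipode_mul hS hy) b]
  induction B.comul z y' x h' b using TensorProduct.induction_on with
  | zero => simp
  | add s t hs ht => simp only [map_add, hs, ht]
  | tmul u v =>
    rw [antipodeMulComul_tmul, LinearMap.rTensor_tmul, AlgHom.toLinearMap_apply]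
    induction B.comul x y z h u using TensorProduct.induction_on with
    | zero => simp
    | add s t hs ht => simp only [mul_add, add_tmul, map_add, hs, ht]
    | tmul p q => simp

theorem IsInvolutory.comulAntipodeMulLeft_comul (hB : B.IsInvolutory) {x y x' z : H}
    (h : x * y = z) (hS : x⁻¹ = x') (h' : x' * z = y) (w : A z) :
    B.comulAntipodeMulLeft h' hS (B.comul x y z h w) = 1 ⊗ₜ w := by
  have hx : x * x' = 1 := by simp [← hS]
  rw [← B.rTensor_assoc_symm_lTensor_comul h' hx h _ _ (hB.lift_antipode_mul hS hx) w]
  induction B.comul x y z h w using TensorProduct.induction_on with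
  | zero => simp
  | add s t hs ht => simp only [map_add, hs, ht]
  | tmul u v =>
    rw [comulAntipodeMulLeft_tmul, LinearMap.lTensor_tmul, AlgHom.toLinearMap_apply]
    induction B.comul x' z y h' v using TensorProduct.induction_on with
    | zero => simp
    | add s t hs ht => simp only [add_mul, tmul_add, map_add, hs, ht]
    | tmul p q => simp

/-! ### Regular characters are integrals -/

/-- The character `a ↦ Tr(b ↦ b a)` of the right regular representation. -/
noncomputable def regularTrace (k R : Type*) [Field k] [Ring R] [Algebra k R] : R →ₗ[k] k :=
  LinearMap.trace k R ∘ₗ (LinearMap.mul k R).flip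

theorem regularTrace_apply {R : Type*} [Ring R] [Algebra k R] (a : R) :
    regularTrace k R a = LinearMap.trace k R (LinearMap.mulRight k a) := rfl

theorem regularTrace_one {R : Type*} [Ring R] [Algebra k R] [FiniteDimensional k R] :
    regularTrace k R 1 = (Module.finrank k R : k) := by
  simp [regularTrace_apply, LinearMap.trace_id]

theorem regularTrace_mul_comm {R : Type*} [Ring R] [Algebra k R] [FiniteDimensional k R]
    (a b : R) :
    regularTrace k R (b * a) = regularTrace k R (a * b) := by
  simp only [regularTrace_apply, LinearMap.mulRight_mul]
  exact LinearMap.trace_comp_comm' _ _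

theorem regularTrace_algEquiv {R S : Type*} [Ring R] [Algebra k R] [Ring S] [Algebra k S]
    (f : R ≃ₐ[k] S) (a : R) : regularTrace k S (f a) = regularTrace k R a := by
  rw [regularTrace_apply, regularTrace_apply,
    ← LinearMap.trace_conj' (LinearMap.mulRight k a) f.toLinearEquiv]
  congr 1
  ext b
  simp [LinearEquiv.conj_apply]

/-- Turns a slice by the character into the trace of a single endomorphism, to which cyclicity
applies. -/
theorem apply_sliceLeft_regularTrace {R S : Type*} [Ring R] [Algebra k R] [Ring S] [Algebra k S]
    (g : S →ₗ[k] k) (t : R ⊗[k] S) :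
    g (sliceLeft S (regularTrace k R) t) = LinearMap.trace k R
      (sliceRight R g ∘ₗ LinearMap.mulRight k t ∘ₗ (TensorProduct.mk k R S).flip 1) := by
  induction t using TensorProduct.induction_on with
  | zero => simp
  | add s t hs ht =>
    rw [map_add, map_add, hs, ht, ← map_add]
    congr 1
    ext b
    simp [mul_add]
  | tmul p q =>
    have : sliceRight R g ∘ₗ LinearMap.mulRight k (p ⊗ₜ q) ∘ₗ (TensorProduct.mk k R S).flip 1 =
        g q • LinearMap.mulRight k p := by
      ext b; simp
    simp [this, regularTrace_apply, mul_comm]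

theorem apply_sliceRight_regularTrace {R S : Type*} [Ring R] [Algebra k R] [Ring S] [Algebra k S]
    (g : R →ₗ[k] k) (t : R ⊗[k] S) :
    g (sliceRight R (regularTrace k S) t) = LinearMap.trace k S
      (sliceLeft S g ∘ₗ LinearMap.mulRight k t ∘ₗ TensorProduct.mk k R S 1) := by
  induction t using TensorProduct.induction_on with
  | zero => simp
  | add s t hs ht =>
    rw [map_add, map_add, hs, ht, ← map_add]
    congr 1
    ext b
    simp [mul_add]
  | tmul p q =>
    have : sliceLeft S g ∘ₗ LinearMap.mulRight k (p ⊗ₜ q) ∘ₗ TensorProduct.mk k R S 1 =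
        g p • LinearMap.mulRight k q := by
      ext b; simp
    simp [this, regularTrace_apply, mul_comm]

theorem contract_mul {R S : Type*} [Ring R] [Algebra k R] [Ring S] [Algebra k S]
    (g : S →ₗ[k] k) (t : R ⊗[k] S) (c : S) :
    contract R ((LinearMap.mul k S).compr₂ g) t c = sliceRight R g ((1 ⊗ₜ c) * t) := by
  induction t using TensorProduct.induction_on with
  | zero => simp
  | add s t hs ht => simp [mul_add, hs, ht]
  | tmul p q => simp

theorem contract_mul_comm {R S : Type*} [Ring R] [Algebra k R] [Ring S] [Algebra k S]
    (g : R →ₗ[k] k) (t : R ⊗[k] S) (c : R) :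
    contract S ((LinearMap.mul k R).compr₂ g) (TensorProduct.comm k R S t) c =
      sliceLeft S g ((c ⊗ₜ 1) * t) := by
  induction t using TensorProduct.induction_on with
  | zero => simp
  | add s t hs ht => simp [mul_add, hs, ht]
  | tmul p q => simp

theorem eq_of_forall_dual {M : Type*} [AddCommGroup M] [Module k M] {u v : M}
    (h : ∀ g : M →ₗ[k] k, g u = g v) : u = v :=
  sub_eq_zero.1 ((Module.forall_dual_apply_eq_zero_iff k _).1 fun g => by simp [h g])

theorem IsInvolutory.sliceLeft_regularTrace (hB : B.IsInvolutory) (hfin : B.IsFiniteType)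
    {x y z : H} (h : x * y = z) (a : A z) :
    sliceLeft (A y) (regularTrace k (A x)) (B.comul x y z h a) = regularTrace k (A z) a • 1 := by
  have := hfin x
  have := hfin z
  have h' : z * y⁻¹ = x := by simp [← h]
  refine eq_of_forall_dual (k := k) fun g => ?_
  set F : A x →ₗ[k] A z ⊗[k] A y := TensorProduct.map (LinearMap.mulRight k a)
    (B.antipode y y⁻¹ rfl).toLinearMap ∘ₗ (B.comul z y⁻¹ x h').toLinearMap with hF
  set G : A z →ₗ[k] A x ⊗[k] A y := (B.comul x y z h).toLinearMap with hG
  set β : A y →ₗ[k] A y →ₗ[k] k := (LinearMap.mul k (A y)).compr₂ g with hβ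
  -- Substituting `b ⊗ 1 = (1 ⊗ S(b₂)) Δ(b₁)` factors the endomorphism through `A z`; this needs
  -- involutivity.
  have e1 : sliceRight (A x) g ∘ₗ LinearMap.mulRight k (B.comul x y z h a) ∘ₗ
      (TensorProduct.mk k (A x) (A y)).flip 1 =
      TensorProduct.lift (contract (A x) β ∘ₗ G) ∘ₗ F := by
    ext b
    have : ∀ t, sliceRight (A x) g (B.antipodeMulComul h rfl t * B.comul x y z h a) =
        TensorProduct.lift (contract (A x) β ∘ₗ G) (TensorProduct.map (LinearMap.mulRight k a)
          (B.antipode y y⁻¹ rfl).toLinearMap t) := by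
      intro t
      induction t using TensorProduct.induction_on with
      | zero => simp
      | add s t hs ht => simp only [add_mul, map_add, hs, ht]
      | tmul u v => simp [hβ, hG, contract_mul, mul_assoc]
    simp [hF, ← this, hB.antipodeMulComul_comul]
  -- In the opposite order the map is `w ↦ g(S(w₂) w₃) w₁ a`, which the ordinary antipode axiom
  -- collapses.
  have e2 : TensorProduct.lift (contract (A z) β.flip ∘ₗ F) ∘ₗ G =
      g 1 • LinearMap.mulRight k a := by
    ext b
    have : ∀ t, TensorProduct.lift (contract (A z) β.flip ∘ₗ F) t =
        sliceRight (A z) g (B.comulAntipodeMul h' rfl t) * a := by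
      intro t
      induction t using TensorProduct.induction_on with
      | zero => simp
      | add s t hs ht => simp only [add_mul, map_add, hs, ht]
      | tmul p q =>
        simp only [hF, TensorProduct.lift.tmul, LinearMap.comp_apply, comulAntipodeMul_tmul,
          AlgHom.toLinearMap_apply]
        induction B.comul z y⁻¹ x h' p using TensorProduct.induction_on with
        | zero => simp
        | add s t hs ht => simp only [add_mul, map_add, LinearMap.add_apply, hs, ht]
        | tmul u v => simp [hβ]
    simp [hG, this, B.comulAntipodeMul_comul]
  rw [apply_sliceLeft_regularTrace, e1, trace_lift_contract_comp, e2]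
  simp [regularTrace_apply, mul_comm]

theorem IsInvolutory.sliceRight_regularTrace (hB : B.IsInvolutory) (hfin : B.IsFiniteType)
    {x y z : H} (h : x * y = z) (a : A z) :
    sliceRight (A x) (regularTrace k (A y)) (B.comul x y z h a) = regularTrace k (A z) a • 1 := by
  have := hfin y
  have := hfin z
  have h' : x⁻¹ * z = y := by simp [← h]
  refine eq_of_forall_dual (k := k) fun g => ?_
  set F : A y →ₗ[k] A z ⊗[k] A x := TensorProduct.map (LinearMap.mulRight k a)
    (B.antipode x x⁻¹ rfl).toLinearMap ∘ₗ (TensorProduct.comm k _ _).toLinearMap ∘ₗ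
      (B.comul x⁻¹ z y h').toLinearMap with hF
  set G : A z →ₗ[k] A y ⊗[k] A x :=
    (TensorProduct.comm k _ _).toLinearMap ∘ₗ (B.comul x y z h).toLinearMap with hG
  set β : A x →ₗ[k] A x →ₗ[k] k := (LinearMap.mul k (A x)).compr₂ g with hβ
  -- The two cancellations trade roles: here `1 ⊗ b = (S(b₁) ⊗ 1) Δ(b₂)` holds without involutivity,
  -- while `e2` needs `S(w₂) w₁ ⊗ w₃ = 1 ⊗ w`.
  have e1 : sliceLeft (A y) g ∘ₗ LinearMap.mulRight k (B.comul x y z h a) ∘ₗ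
      TensorProduct.mk k (A x) (A y) 1 = TensorProduct.lift (contract (A y) β ∘ₗ G) ∘ₗ F := by
    ext b
    have : ∀ t, sliceLeft (A y) g (B.antipodeMulComulLeft h rfl t * B.comul x y z h a) =
        TensorProduct.lift (contract (A y) β ∘ₗ G) (TensorProduct.map (LinearMap.mulRight k a)
          (B.antipode x x⁻¹ rfl).toLinearMap (TensorProduct.comm k _ _ t)) := by
      intro t
      induction t using TensorProduct.induction_on with
      | zero => simp
      | add s t hs ht => simp only [add_mul, map_add, hs, ht]
      | tmul u v => simp [hβ, hG, contract_mul_comm, mul_assoc]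
    simp [hF, ← this, B.antipodeMulComulLeft_comul]
  have e2 : TensorProduct.lift (contract (A z) β.flip ∘ₗ F) ∘ₗ G =
      g 1 • LinearMap.mulRight k a := by
    ext b
    have : ∀ t, TensorProduct.lift (contract (A z) β.flip ∘ₗ F) (TensorProduct.comm k _ _ t) =
        sliceLeft (A z) g (B.comulAntipodeMulLeft h' rfl t) * a := by
      intro t
      induction t using TensorProduct.induction_on with
      | zero => simp
      | add s t hs ht => simp only [add_mul, map_add, hs, ht]
      | tmul p q =>
        simp only [hF, TensorProduct.comm_tmul, TensorProduct.lift.tmul, LinearMap.comp_apply,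
          comulAntipodeMulLeft_tmul, AlgHom.toLinearMap_apply, LinearEquiv.coe_coe]
        induction B.comul x⁻¹ z y h' q using TensorProduct.induction_on with
        | zero => simp
        | add s t hs ht => simp only [add_mul, map_add, LinearMap.add_apply, hs, ht]
        | tmul u v => simp [hβ]
    simp [hG, this, hB.comulAntipodeMulLeft_comul]
  rw [apply_sliceRight_regularTrace, e1, trace_lift_contract_comp, e2]
  simp [regularTrace_apply, mul_comm]

/-! ### The integral element as a partial trace -/

/-- For `t = u ⊗ v` the left factor `S(v)` comes out of the slice and moves cyclically next to `u`.
At `t = Δ(a)` the two sides become `g(aΛ)` and `ε(a) g(Λ)`. -/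
theorem trace_sliceLeft_antipodeMulComul (hfin : B.IsFiniteType) (g : A 1 →ₗ[k] k)
    (t : A 1 ⊗[k] A 1) :
    LinearMap.trace k (A 1) (sliceLeft (A 1) g ∘ₗ
        LinearMap.mulLeft k (B.antipodeMulComul (mul_one 1) inv_one t) ∘ₗ
        (B.comul 1 1 1 (mul_one 1)).toLinearMap) =
      LinearMap.trace k (A 1) (sliceLeft (A 1) g ∘ₗ (B.comul 1 1 1 (mul_one 1)).toLinearMap ∘ₗ
        LinearMap.mulLeft k
          (LinearMap.mul' k (A 1) ((B.antipode 1 1 inv_one).toLinearMap.lTensor (A 1) t))) := by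
  have := hfin 1
  induction t using TensorProduct.induction_on with
  | zero => simp
  | add s t hs ht =>
    have h1 (a b : A 1 ⊗[k] A 1) :
        LinearMap.mulLeft k (a + b) = LinearMap.mulLeft k a + LinearMap.mulLeft k b := by
      ext; simp [add_mul]
    have h2 (a b : A 1) :
        LinearMap.mulLeft k (a + b) = LinearMap.mulLeft k a + LinearMap.mulLeft k b := by
      ext; simp [add_mul]
    simp only [map_add, h1, h2, LinearMap.comp_add, LinearMap.add_comp, hs, ht]
  | tmul u v =>
    have h1 : sliceLeft (A 1) g ∘ₗ
        LinearMap.mulLeft k (B.antipodeMulComul (mul_one 1) inv_one (u ⊗ₜ v)) ∘ₗ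
        (B.comul 1 1 1 (mul_one 1)).toLinearMap =
        LinearMap.mulLeft k (B.antipode 1 1 inv_one v) ∘ₗ (sliceLeft (A 1) g ∘ₗ
          (B.comul 1 1 1 (mul_one 1)).toLinearMap ∘ₗ LinearMap.mulLeft k u) := by
      ext b
      simp [sliceLeft_one_tmul_mul]
    rw [h1, LinearMap.trace_comp_comm']
    simp [LinearMap.comp_assoc]

theorem trace_sliceLeft_comulMulAntipode (hfin : B.IsFiniteType) (g : A 1 →ₗ[k] k)
    (t : A 1 ⊗[k] A 1) :
    LinearMap.trace k (A 1) (sliceLeft (A 1) g ∘ₗ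
        LinearMap.mulRight k (B.comulMulAntipode (mul_one 1) inv_one t) ∘ₗ
        (B.comul 1 1 1 (mul_one 1)).toLinearMap) =
      LinearMap.trace k (A 1) (sliceLeft (A 1) g ∘ₗ (B.comul 1 1 1 (mul_one 1)).toLinearMap ∘ₗ
        LinearMap.mulRight k (TensorProduct.lift ((LinearMap.mul k (A 1)).flip.compl₂
          (B.antipode 1 1 inv_one).toLinearMap) t)) := by
  have := hfin 1
  induction t using TensorProduct.induction_on with
  | zero => simp
  | add s t hs ht =>
    have h1 (a b : A 1 ⊗[k] A 1) :
        LinearMap.mulRight k (a + b) = LinearMap.mulRight k a + LinearMap.mulRight k b := by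
      ext; simp [mul_add]
    have h2 (a b : A 1) :
        LinearMap.mulRight k (a + b) = LinearMap.mulRight k a + LinearMap.mulRight k b := by
      ext; simp [mul_add]
    simp only [map_add, h1, h2, LinearMap.comp_add, LinearMap.add_comp, hs, ht]
  | tmul u v =>
    have h1 : sliceLeft (A 1) g ∘ₗ
        LinearMap.mulRight k (B.comulMulAntipode (mul_one 1) inv_one (u ⊗ₜ v)) ∘ₗ
        (B.comul 1 1 1 (mul_one 1)).toLinearMap =
        LinearMap.mulRight k (B.antipode 1 1 inv_one v) ∘ₗ (sliceLeft (A 1) g ∘ₗ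
          (B.comul 1 1 1 (mul_one 1)).toLinearMap ∘ₗ LinearMap.mulRight k u) := by
      ext b
      simp [sliceLeft_mul_one_tmul]
    rw [h1, LinearMap.trace_comp_comm']
    simp [LinearMap.comp_assoc]

/-- The element of `A₁` which represents the partial trace of the coproduct, that is, the
character of the regular representation of the dual algebra. -/
theorem exists_apply_eq_trace (hfin : B.IsFiniteType) :
    ∃ Λ : A 1, ∀ g : A 1 →ₗ[k] k, g Λ = LinearMap.trace k (A 1)
      (sliceLeft (A 1) g ∘ₗ (B.comul 1 1 1 (mul_one 1)).toLinearMap) := by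
  have := hfin 1
  let Φ : Module.Dual k (Module.Dual k (A 1)) :=
    LinearMap.trace k (A 1) ∘ₗ LinearMap.lcomp k (A 1) (B.comul 1 1 1 (mul_one 1)).toLinearMap ∘ₗ
      LinearMap.llcomp k (A 1 ⊗[k] A 1) (k ⊗[k] A 1) (A 1) (TensorProduct.lid k (A 1)).toLinearMap ∘ₗ
      LinearMap.rTensorHom (A 1)
  -- The trace is linear in `g`, hence an element of the bidual, and `A 1` is reflexive.
  refine ⟨(Module.evalEquiv k (A 1)).symm Φ, fun g => ?_⟩
  rw [Module.apply_evalEquiv_symm_apply]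
  rfl

theorem IsInvolutory.isIntegralElement_of_apply_eq_trace (hB : B.IsInvolutory)
    (hfin : B.IsFiniteType) {Λ : A 1} (hΛ : ∀ g : A 1 →ₗ[k] k, g Λ = LinearMap.trace k (A 1)
      (sliceLeft (A 1) g ∘ₗ (B.comul 1 1 1 (mul_one 1)).toLinearMap)) :
    B.IsIntegralElement Λ := by
  refine fun a => ⟨eq_of_forall_dual (k := k) fun g => ?_, eq_of_forall_dual (k := k) fun g => ?_⟩
  · have key := trace_sliceLeft_comulMulAntipode hfin g (B.comul 1 1 1 (mul_one 1) a)
    rw [comulMulAntipode_comul, hB.lift_antipode_mul] at key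
    have h1 : sliceLeft (A 1) (g ∘ₗ LinearMap.mulRight k a) =
        sliceLeft (A 1) g ∘ₗ LinearMap.mulRight k (a ⊗ₜ 1) := by
      ext; simp
    have h2 : LinearMap.mulRight k (B.counit a • (1 : A 1)) = B.counit a • LinearMap.id := by
      ext; simp
    rw [h2, LinearMap.comp_smul, LinearMap.comp_smul, map_smul, LinearMap.comp_id, ← hΛ,
      ← LinearMap.comp_assoc, ← h1, ← hΛ] at key
    simpa using key
  · have key := trace_sliceLeft_antipodeMulComul hfin g (B.comul 1 1 1 (mul_one 1) a)
    rw [hB.antipodeMulComul_comul, id_mul_antipode_apply] at key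
    have h1 : sliceLeft (A 1) (g ∘ₗ LinearMap.mulLeft k a) =
        sliceLeft (A 1) g ∘ₗ LinearMap.mulLeft k (a ⊗ₜ 1) := by
      ext; simp
    have h2 : LinearMap.mulLeft k (B.counit a • (1 : A 1)) = B.counit a • LinearMap.id := by
      ext; simp
    rw [h2, LinearMap.comp_smul, LinearMap.comp_smul, map_smul, LinearMap.comp_id, ← hΛ,
      ← LinearMap.comp_assoc, ← h1, ← hΛ] at key
    simpa using key

/-! ### Pairing an integral with the coproduct of `Λ` -/

/-- Expand `a ⊗ 1 = (1 ⊗ S(a₂)) Δ(a₁)`; then `Δ(a₁) Δ(Λ) = ε(a₁) Δ(Λ)` because `Λ` is integral, and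
slicing `Δ(Λ)` leaves the scalar `l 1 Λ`. -/
theorem IsInvolutory.sliceLeft_tmul_one_mul_comul (hB : B.IsInvolutory) {l : ∀ x, A x →ₗ[k] k}
    (hl : ∀ (x y z : H) (h : x * y = z) (a : A z),
      sliceLeft (A y) (l x) (B.comul x y z h a) = l z a • 1)
    {Λ : A 1} (hΛ : B.IsIntegralElement Λ) {x y : H} (hS : x⁻¹ = y) (h : y * x = 1) (a : A y) :
    sliceLeft (A x) (l y) ((a ⊗ₜ 1) * B.comul y x 1 h Λ) = l 1 Λ • B.antipode x y hS a := by
  rw [← hB.antipodeMulComul_comul h hS (one_mul y)]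
  conv_rhs => rw [← B.sliceLeft_counit_comul y (one_mul y) a]
  induction B.comul 1 y y (one_mul y) a using TensorProduct.induction_on with
  | zero => simp
  | add s t hs ht => simp only [add_mul, map_add, smul_add, hs, ht]
  | tmul u v =>
    rw [antipodeMulComul_tmul, mul_assoc, ← map_mul, sliceLeft_one_tmul_mul, hl, (hΛ u).2]
    simp [smul_smul, mul_comm]

theorem sliceRight_one_tmul_mul_comul {l : ∀ x, A x →ₗ[k] k}
    (hl : ∀ (x y z : H) (h : x * y = z) (a : A z),
      sliceRight (A x) (l y) (B.comul x y z h a) = l z a • 1)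
    {Λ : A 1} (hΛ : B.IsIntegralElement Λ) {x y : H} (hS : x⁻¹ = y) (h : x * y = 1) (a : A y) :
    sliceRight (A x) (l y) ((1 ⊗ₜ a) * B.comul x y 1 h Λ) = l 1 Λ • B.antipode x y hS a := by
  rw [← B.antipodeMulComulLeft_comul h hS (mul_one y)]
  conv_rhs => rw [← B.sliceRight_counit_comul y (mul_one y) a]
  induction B.comul y 1 y (mul_one y) a using TensorProduct.induction_on with
  | zero => simp
  | add s t hs ht => simp only [add_mul, map_add, smul_add, hs, ht]
  | tmul u v =>
    rw [antipodeMulComulLeft_tmul, mul_assoc, ← map_mul, sliceRight_tmul_one_mul, hl, (hΛ v).2]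
    simp [smul_smul, mul_comm]

/-- In finite dimension the functionals `f ⊗ g` span the dual of `M ⊗ N`, and each factors through
the slice by `f`. -/
theorem eq_of_forall_sliceLeft {M N : Type*} [AddCommGroup M] [Module k M] [AddCommGroup N]
    [Module k N] [FiniteDimensional k M] [FiniteDimensional k N] {s t : M ⊗[k] N}
    (h : ∀ f : M →ₗ[k] k, sliceLeft N f s = sliceLeft N f t) : s = t := by
  refine eq_of_forall_dual (k := k) fun φ => ?_
  obtain ⟨r, rfl⟩ := (TensorProduct.dualDistribEquiv k M N).surjective φ
  have key (f : M →ₗ[k] k) (g : N →ₗ[k] k) (t : M ⊗[k] N) :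
      TensorProduct.dualDistrib k M N (f ⊗ₜ g) t = g (sliceLeft N f t) := by
    induction t using TensorProduct.induction_on with
    | zero => simp
    | add s t hs ht => simp only [map_add, hs, ht]
    | tmul u v => simp
  change TensorProduct.dualDistrib k M N r s = TensorProduct.dualDistrib k M N r t
  induction r using TensorProduct.induction_on with
  | zero => simp
  | add s t hs ht => simp only [map_add, LinearMap.add_apply, hs, ht]
  | tmul f g => rw [key, key, h]

/-- The bilinear form `(a, b) ↦ l_y (a b)` is nondegenerate. -/
theorem IsInvolutory.surjective_mul_compr₂ (hB : B.IsInvolutory) (hfin : B.IsFiniteType)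
    {l : ∀ x, A x →ₗ[k] k}
    (hl : ∀ (x y z : H) (h : x * y = z) (a : A z),
      sliceLeft (A y) (l x) (B.comul x y z h a) = l z a • 1)
    {Λ : A 1} (hΛ : B.IsIntegralElement Λ) (hn : l 1 Λ ≠ 0) (y : H) :
    Function.Surjective ((LinearMap.mul k (A y)).compr₂ (l y)) := by
  have := hfin y
  refine (LinearMap.injective_iff_surjective_of_finrank_eq_finrank
    (Subspace.dual_finrank_eq (K := k) (V := A y)).symm).1 ?_
  -- Dimensions agree, so injectivity suffices: if `l y (a * ·)` vanishes, then `l 1 Λ • S(a) = 0`,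
  -- hence `a = 0`.
  refine (injective_iff_map_eq_zero _).2 fun a ha => ?_
  have hS : (y⁻¹)⁻¹ = y := inv_inv y
  have key := hB.sliceLeft_tmul_one_mul_comul hl hΛ hS (mul_inv_cancel y) a
  have h0 : ∀ t : A y ⊗[k] A y⁻¹, sliceLeft (A y⁻¹) (l y) ((a ⊗ₜ 1) * t) =
      sliceLeft (A y⁻¹) ((LinearMap.mul k (A y)).compr₂ (l y) a) t := by
    intro t
    induction t using TensorProduct.induction_on with
    | zero => simp
    | add s t hs ht => simp only [mul_add, map_add, hs, ht]
    | tmul u v => simp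
  rw [h0, ha] at key
  have hz : sliceLeft (A y⁻¹) (0 : A y →ₗ[k] k) = 0 := by ext; simp
  rw [hz, LinearMap.zero_apply, eq_comm, smul_eq_zero, or_iff_right hn] at key
  simpa using key

end HopfGroupCoalgebra

namespace HopfCrossedCoalgebra

variable {k : Type*} [Field k] {E H : Type*} [Group E] [Group H] {χ : CrossedModule E H}
  {A : H → Type*} [∀ x, Ring (A x)] [∀ x, Algebra k (A x)] (B : HopfCrossedCoalgebra k χ A)

/-! ### The crossed action, normalization and uniqueness -/

theorem action_apply_of_eq_one {x : H} {e : E} (he : e = 1) (h : χ.hom e * x = x) (a : A x) :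
    B.action x e x h a = a := by
  subst he
  rw [B.action_one]
  rfl

/-- The maps `φ_{x,e}` are isomorphisms of algebras. -/
noncomputable def actionEquiv {x y : H} (e : E) (h : χ.hom e * x = y) : A x ≃ₐ[k] A y :=
  AlgEquiv.ofAlgHom (B.action x e y h) (B.action y e⁻¹ x (by simp [← h]))
    (by
      rw [B.action_mul _ _ _ _ _ _ _ (by simp)]
      ext a
      exact B.action_apply_of_eq_one (by simp) _ a)
    (by
      rw [B.action_mul _ _ _ _ _ _ _ (by simp)]
      ext a
      exact B.action_apply_of_eq_one (by simp) _ a)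

open HopfGroupCoalgebra

variable {B}

theorem isIntegral_regularTrace (hB : B.IsInvolutory) (hfin : B.IsFiniteType) :
    B.IsIntegral fun x => regularTrace k (A x) where
  id_tensor x y z h := by
    ext a
    exact (hB.sliceRight_regularTrace hfin h a).trans (Algebra.algebraMap_eq_smul_one _).symm
  tensor_id x y z h := by
    ext a
    exact (hB.sliceLeft_regularTrace hfin h a).trans (Algebra.algebraMap_eq_smul_one _).symm
  comp_action x e y h := by
    ext a
    exact regularTrace_algEquiv (B.actionEquiv e h) a

theorem IsIntegral.sliceRight {l : ∀ x, A x →ₗ[k] k} (hl : B.IsIntegral l) (x y z : H)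
    (h : x * y = z) (a : A z) :
    sliceRight (A x) (l y) (B.comul x y z h a) = l z a • 1 :=
  (LinearMap.congr_fun (hl.id_tensor x y z h) a).trans (Algebra.algebraMap_eq_smul_one _)

theorem IsIntegral.sliceLeft {l : ∀ x, A x →ₗ[k] k} (hl : B.IsIntegral l) (x y z : H)
    (h : x * y = z) (a : A z) :
    sliceLeft (A y) (l x) (B.comul x y z h a) = l z a • 1 :=
  (LinearMap.congr_fun (hl.tensor_id x y z h) a).trans (Algebra.algebraMap_eq_smul_one _)

theorem IsIntegral.apply_one {l : ∀ x, A x →ₗ[k] k} (hl : B.IsIntegral l) (x : H)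
    [hx : Nontrivial (A x)] : l x 1 = l 1 1 := by
  have : Nontrivial (A x⁻¹) := (B.antipode x x⁻¹ rfl).toEquiv.nontrivial
  have h := hl.sliceLeft x x⁻¹ 1 (mul_inv_cancel x) 1
  rw [map_one, Algebra.TensorProduct.one_def, sliceLeft_tmul] at h
  exact smul_left_injective k one_ne_zero h

/-- Evaluate `(l_1 ⊗ l'_y) Δ_{1,y}(a)` in both orders. -/
theorem IsIntegral.mul_apply_eq {l l' : ∀ x, A x →ₗ[k] k} (hl : B.IsIntegral l)
    (hl' : B.IsIntegral l') (y : H) (a : A y) : l 1 1 * l' y a = l y a * l' y 1 := by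
  have key (t : A 1 ⊗[k] A y) : l 1 (TensorProduct.sliceRight (A 1) (l' y) t) =
      l' y (TensorProduct.sliceLeft (A y) (l 1) t) := by
    induction t using TensorProduct.induction_on with
    | zero => simp
    | add s t hs ht => simp only [map_add, hs, ht]
    | tmul u v => simp [mul_comm]
  have h := key (B.comul 1 y y (one_mul y) a)
  rw [hl.sliceLeft, hl'.sliceRight] at h
  simpa [mul_comm] using h

end HopfCrossedCoalgebra

open HopfGroupCoalgebra HopfCrossedCoalgebra

theorem lemma3p3 {k : Type*} [Field k] {E H : Type*} [Group E] [Group H] (χ : CrossedModule E H)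
    (A : H → Type*) [∀ x, Ring (A x)] [∀ x, Algebra k (A x)] (B : HopfCrossedCoalgebra k χ A)
    (hfin : B.IsFiniteType) (hinv : B.IsInvolutory)
    (hchar : ¬ ringChar k ∣ Module.finrank k (A 1)) :
    ∃ (Λ : A 1) (l : ∀ x, A x →ₗ[k] k),
      -- existence
      B.IsIntegralElement Λ ∧ B.IsIntegral l ∧
      (∀ x, Nontrivial (A x) → l x 1 = (Module.finrank k (A 1) : k)) ∧
      l 1 Λ = (Module.finrank k (A 1) : k) ∧
      B.counit Λ = (Module.finrank k (A 1) : k) ∧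
      -- uniqueness of each of the two
      (∀ Λ' : A 1, B.IsIntegralElement Λ' →
        B.counit Λ' = (Module.finrank k (A 1) : k) → Λ' = Λ) ∧
      (∀ l' : ∀ x, A x →ₗ[k] k, B.IsIntegral l' →
        (∀ x, Nontrivial (A x) → l' x 1 = (Module.finrank k (A 1) : k)) → l' = l) ∧
      -- symmetry and invariance under the antipode
      B.IsCosymmetric Λ ∧
      (∀ (x : H) (a b : A x), l x (b * a) = l x (a * b)) ∧
      B.antipode 1 1 inv_one Λ = Λ ∧
      (∀ (x y : H) (h : x⁻¹ = y) (a : A y), l x (B.antipode x y h a) = l y a) := by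
  have hn : (Module.finrank k (A 1) : k) ≠ 0 := fun h => hchar ((ringChar.spec k _).1 h)
  set n : k := (Module.finrank k (A 1) : k) with hn_def
  have := hfin 1
  obtain ⟨Λ, hΛt⟩ := exists_apply_eq_trace hfin
  have hΛ := hinv.isIntegralElement_of_apply_eq_trace hfin hΛt
  set l : ∀ x, A x →ₗ[k] k := fun x => regularTrace k (A x) with hl_def
  have hl : B.IsIntegral l := isIntegral_regularTrace hinv hfin
  have hl1 : l 1 1 = n := regularTrace_one
  have hone : ∀ x, Nontrivial (A x) → l x 1 = n := fun x _ => (hl.apply_one x).trans hl1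
  have hcomm : ∀ (x : H) (a b : A x), l x (b * a) = l x (a * b) := fun x a b =>
    have := hfin x
    regularTrace_mul_comm a b
  have hεΛ : B.counit Λ = n := by
    have h : sliceLeft (A 1) B.counit.toLinearMap ∘ₗ (B.comul 1 1 1 (mul_one 1)).toLinearMap =
        LinearMap.id := B.counit_comul 1
    have h' := hΛt B.counit.toLinearMap
    rwa [h, LinearMap.trace_id] at h'
  -- Slicing by the integral gives the rank-one map `a ↦ l 1 a • 1`, whose trace is `l 1 1`.
  have hlΛ : l 1 Λ = n := by
    have h : sliceLeft (A 1) (l 1) ∘ₗ (B.comul 1 1 1 (mul_one 1)).toLinearMap =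
        (l 1).smulRight 1 := by
      ext a
      exact hl.sliceLeft 1 1 1 _ a
    rw [hΛt, h, LinearMap.trace_smulRight, hl1]
  have hlΛ0 : l 1 Λ ≠ 0 := hlΛ ▸ hn
  refine ⟨Λ, l, hΛ, hl, hone, hlΛ, hεΛ, fun Λ' hΛ' hε => ?_, fun l' hl' hone' => ?_, ?_, hcomm,
    ?_, fun x y h a => ?_⟩
  -- Compute `Λ * Λ'` using the integrality of each factor.
  · have h := (hΛ Λ').1.symm.trans (hΛ' Λ).2
    rw [hε, hεΛ] at h
    exact (smul_right_injective (A 1) hn h).symm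
  · ext x a
    rcases subsingleton_or_nontrivial (A x) with hx | hx
    · simp [Subsingleton.elim a 0]
    · have h := hl.mul_apply_eq hl' x a
      rw [hl1, hone' x hx, mul_comm] at h
      exact mul_right_cancel₀ hn h
  · intro x y hx hy h h'
    have := hfin x
    have := hfin y
    have hxy : x * y = 1 := by simp [← hx]
    refine eq_of_forall_sliceLeft fun f => ?_
    -- By nondegeneracy every functional is `l y (a * ·)`, and for these both slices equal `l 1 Λ •
    -- S(a)`.
    obtain ⟨a, rfl⟩ := hinv.surjective_mul_compr₂ hfin hl.sliceLeft hΛ hlΛ0 y f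
    have e1 (t : A y ⊗[k] A x) : sliceLeft (A x) ((LinearMap.mul k (A y)).compr₂ (l y) a) t =
        sliceLeft (A x) (l y) ((a ⊗ₜ 1) * t) := by
      induction t using TensorProduct.induction_on with
      | zero => simp
      | add s t hs ht => simp only [mul_add, map_add, hs, ht]
      | tmul u v => simp
    have e2 (t : A x ⊗[k] A y) : sliceLeft (A x) (l y) ((a ⊗ₜ 1) * TensorProduct.comm k _ _ t) =
        sliceRight (A x) (l y) ((1 ⊗ₜ a) * t) := by
      induction t using TensorProduct.induction_on with
      | zero => simp
      | add s t hs ht => simp only [mul_add, map_add, hs, ht]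
      | tmul u v => simp
    rw [e1, e1, hinv.sliceLeft_tmul_one_mul_comul hl.sliceLeft hΛ hx h',
      ← sliceRight_one_tmul_mul_comul hl.sliceRight hΛ hx hxy, ← e2]
    rfl
  -- With `a = Λ`, integrality turns the slice by `l 1 (Λ * ·)` into `l 1 Λ` times the slice by the
  -- counit.
  · have h := hinv.sliceLeft_tmul_one_mul_comul hl.sliceLeft hΛ inv_one (one_mul 1) Λ
    have e (t : A 1 ⊗[k] A 1) (ht : ∀ a : A 1, Λ * a = B.counit a • Λ) :
        sliceLeft (A 1) (l 1) ((Λ ⊗ₜ 1) * t) =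
          l 1 Λ • sliceLeft (A 1) B.counit.toLinearMap t := by
      induction t using TensorProduct.induction_on with
      | zero => simp
      | add s t hs ht => simp only [mul_add, map_add, smul_add, hs, ht]
      | tmul u v => simp [ht, smul_smul, mul_comm]
    rw [e _ fun a => (hΛ a).1, B.sliceLeft_counit_comul] at h
    exact (smul_right_injective (A 1) hlΛ0 h).symm
  · have hyx : y * x = 1 := by simp [← h]
    -- Slicing the other leg first replaces `Δ(Λ)` by `l 1 Λ • 1`, so both sides carry the nonzero
    -- factor `l 1 Λ`.
    have key := congrArg (l x) (hinv.sliceLeft_tmul_one_mul_comul hl.sliceLeft hΛ h hyx a)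
    have e (t : A y ⊗[k] A x) : l x (sliceLeft (A x) (l y) ((a ⊗ₜ 1) * t)) =
        l y (a * sliceRight (A y) (l x) t) := by
      induction t using TensorProduct.induction_on with
      | zero => simp
      | add s t hs ht => simp only [mul_add, map_add, hs, ht]
      | tmul u v => simp [mul_comm]
    rw [e, hl.sliceRight, mul_smul_comm, mul_one, map_smul, map_smul] at key
    exact (mul_left_cancel₀ hlΛ0 key).symm
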